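/- Let $S$ be a finite nonempty set, $n=|S|$, and let $p:2^S\to\mathbb Z\cup\{-\infty\}$ be an integer-valued (fully) supermodular set function, i.e. $p(X)+p(Y)\le p(X\cap Y)+p(X\cup Y)$ for all $X,Y\subseteq S$ with $p(X),p(Y)>-\infty$, with $p(\emptyset)=0$ and $p(S)$ finite. Let $$B=\{x\in\mathbb R^S:\ \textstyle\sum_{s\in S}x(s)=p(S),\ \sum_{s\in Z}x(s)\ge p(Z)\ \text{for every } Z\subset S\}$$ be the (integral) base-polyhedron defined by $p$; the set $B\cap\mathbb Z^S$ of its integral points is called an M-convex set. For $\pi\in\mathbb Z^S$ let $\hat p(\pi)$ denote the linear (Lovász) extension of $p$, $$\hat p(\pi)=p(I_n)\,\pi(s_n)+\sum_{j=1}^{n-1}p(I_j)\,[\pi(s_j)-\pi(s_{j+1})],$$ where the elements of $S$ are indexed so that $\pi(s_1)\ge\dots\ge\pi(s_n)$, $I_j=\{s_1,\dots,s_j\}$, and $(-\infty)\cdot 0=0$. For each $s\in S$ let $\varphi_s:\mathbb Z\to\mathbb Z\cup\{+\infty\}$ be discrete convex, i.e. $\operatorname{dom}\varphi_s=\{k\in\mathbb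 Z:\varphi_s(k)<+\infty\}$ is an interval of integers (possibly unbounded) and $\varphi_s(k-1)+\varphi_s(k+1)\ge 2\varphi_s(k)$ for all $k\in\operatorname{dom}\varphi_s$. Let $\psi_s(\ell)=\sup\{k\ell-\varphi_s(k):k\in\mathbb Z\}$ $(\ell\in\mathbb Z)$ be its integer conjugate. (If $\varphi_s\equiv+\infty$, then $\psi_s\equiv-\infty$; a sum containing $-\infty$ is $-\infty$.) Assume that (i) there exists $x\in B\cap\mathbb Z^S$ such that $\varphi_s(x(s))<+\infty$ for all $s\in S$ (primal feasibility), or (ii) there exists $\pi\in\mathbb Z^S$ such that $\hat p(\pi)>-\infty$ and $\psi_s(\pi(s))<+\infty$ for all $s\in S$ (dual feasibility). Then, in $\mathbb Z\cup\{-\infty,+\infty\}$, $$\min\Bigl\{\sum_{s\in S}\varphi_s(x(s)):x\in B\cap\mathbb Z^S\Bigr\}=\max\Bigl\{\hat p(\pi)-\sum_{s\in S}\psi_s(\pi(s)):\pi\in\mathbb Z^S\Bigr\},$$ where $\min$ and $\max$ are understood as infimum and supremum, both sides being allowed to be $-\infty$ or $+\infty$; if the common value is finite, it is an integer, and both the minimum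 and the maximum are attained. -/

import Mathlib

namespace SepConvex

/-- Inclusion of `ℤ ∪ {+∞}` into the extended reals. -/
noncomputable def topToEReal : WithTop ℤ → EReal
  | none => ⊤
  | some n => ((n : ℝ) : EReal)

/-- Inclusion of `ℤ ∪ {-∞}` into the extended reals. -/
noncomputable def botToEReal : WithBot ℤ → EReal
  | none => ⊥
  | some n => ((n : ℝ) : EReal)

/-- `φ : ℤ → ℤ ∪ {+∞}` is discrete convex: the effective domain is an interval of integers and
`φ (k - 1) + φ (k + 1) ≥ 2 φ k` for every `k` in it. -/
structure DiscreteConvex (φ : ℤ → WithTop ℤ) : Prop where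
  ordConnected_dom : {k : ℤ | φ k ≠ ⊤}.OrdConnected
  two_nsmul_le : ∀ k : ℤ, φ k ≠ ⊤ → 2 • φ k ≤ φ (k - 1) + φ (k + 1)

/-- The integer conjugate `ψ ℓ = sup {k ℓ - φ k : k ∈ ℤ}`. -/
noncomputable def intConj (φ : ℤ → WithTop ℤ) (l : ℤ) : EReal :=
  ⨆ k : ℤ, (((k * l : ℤ) : ℝ) : EReal) - topToEReal (φ k)

variable {S : Type*}

/-- The integral members of a subset of `ℝ^S`. -/
def integerPoints (B : Set (S → ℝ)) : Set (S → ℤ) :=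
  {x | (fun s => (x s : ℝ)) ∈ B}

variable [Fintype S]

/-- An enumeration of `S` along which `π` is non-increasing. -/
noncomputable def sortedEnum (π : S → ℤ) : Fin (Fintype.card S) ≃ S :=
  (Tuple.sort fun i => -π ((Fintype.equivFin S).symm i)).trans (Fintype.equivFin S).symm

theorem antitone_sortedEnum (π : S → ℤ) : Antitone (π ∘ sortedEnum π) := by
  intro i j hij
  have := Tuple.monotone_sort (fun i => -π ((Fintype.equivFin S).symm i)) hij
  simpa [sortedEnum] using this

/-- An integer-valued (fully) supermodular set function `p`, with `p X = -∞` allowed,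
`p ∅ = 0` and `p S` finite. -/
structure IsSupermodular [DecidableEq S] (p : Finset S → WithBot ℤ) : Prop where
  empty : p ∅ = 0
  univ_ne_bot : p Finset.univ ≠ ⊥
  supermodular : ∀ X Y : Finset S, p X ≠ ⊥ → p Y ≠ ⊥ → p X + p Y ≤ p (X ∩ Y) + p (X ∪ Y)

/-- The base-polyhedron `{x ∈ ℝ^S : x̃ S = p S, x̃ Z ≥ p Z for every Z ⊂ S}`,
where `x̃ Z = ∑ s ∈ Z, x s`. -/
def basePolyhedron (p : Finset S → WithBot ℤ) : Set (S → ℝ) :=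
  {x | (p Finset.univ).map (fun n : ℤ => (n : ℝ)) = ((∑ s, x s : ℝ) : WithBot ℝ) ∧
    ∀ Z : Finset S, Z ⊂ Finset.univ →
      (p Z).map (fun n : ℤ => (n : ℝ)) ≤ ((∑ s ∈ Z, x s : ℝ) : WithBot ℝ)}

/-- For an enumeration `s₁, …, sₙ` of `S`, the value
`p(Iₙ) π(sₙ) + ∑_{j < n} p(I_j) (π(s_j) - π(s_{j+1}))` with `I_j = {s₁, …, s_j}`
and the convention `(-∞) · 0 = 0`. -/
def lovaszAlong (p : Finset S → WithBot ℤ) (π : S → ℤ) (e : Fin (Fintype.card S) ≃ S) :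
    WithBot ℤ :=
  ∑ j : Fin (Fintype.card S), p (Finset.univ.filter fun s => e.symm s ≤ j) *
    ((if h : (j : ℕ) + 1 < Fintype.card S then π (e j) - π (e ⟨j + 1, h⟩) else π (e j) : ℤ) :
      WithBot ℤ)

/-- The linear (Lovász) extension of `p` at an integer vector. -/
noncomputable def lovaszExt (p : Finset S → WithBot ℤ) (π : S → ℤ) : WithBot ℤ :=
  lovaszAlong p π (sortedEnum π)

/-- The linear extension does not depend on the non-increasing enumeration. -/
theorem lovaszExt_eq (p : Finset S → WithBot ℤ) (π : S → ℤ) (e : Fin (Fintype.card S) ≃ S)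
    (he : Antitone (π ∘ e)) : lovaszExt p π = lovaszAlong p π e := by
  have key : ∀ e₁ e₂ : Fin (Fintype.card S) ≃ S, Antitone (π ∘ e₁) → Antitone (π ∘ e₂) →
      lovaszAlong p π e₁ = lovaszAlong p π e₂ := by
    intro e₁ e₂ h₁ h₂
    have hπ : ∀ j, π (e₁ j) = π (e₂ j) := by
      have := Tuple.unique_antitone (f := π ∘ e₁) (σ := Equiv.refl _) (τ := e₂.trans e₁.symm)
        (by simpa using h₁)
        (by
          have : (π ∘ e₁) ∘ (e₂.trans e₁.symm) = π ∘ e₂ := by ext j; simp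
          rw [this]; exact h₂)
      intro j
      simpa using congrFun this j
    have lev : ∀ f : Fin (Fintype.card S) ≃ S, Antitone (π ∘ f) →
        ∀ (j : Fin (Fintype.card S)) (h : (j : ℕ) + 1 < Fintype.card S),
        π (f j) ≠ π (f ⟨j + 1, h⟩) → ∀ s, f.symm s ≤ j ↔ π (f j) ≤ π s := by
      intro f hf j h hne s
      constructor
      · intro hs
        simpa using hf hs
      · intro hs
        by_contra hlt
        have h1 : (⟨j + 1, h⟩ : Fin (Fintype.card S)) ≤ f.symm s := by
          rw [Fin.le_def]
          have := Fin.lt_def.1 (not_le.1 hlt)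
          simpa using this
        have h2 := hf h1
        have h3 : π (f ⟨j + 1, h⟩) ≤ π (f j) := hf (by rw [Fin.le_def]; simp)
        simp only [Function.comp_apply, Equiv.apply_symm_apply] at h2
        omega
    unfold lovaszAlong
    refine Finset.sum_congr rfl fun j _ => ?_
    by_cases h : (j : ℕ) + 1 < Fintype.card S
    · simp only [h, dif_pos, ← hπ]
      by_cases hne : π (e₁ j) = π (e₁ ⟨j + 1, h⟩)
      · simp [hne]
      · congr 2
        ext s
        simp only [Finset.mem_filter, Finset.mem_univ, true_and]
        rw [lev e₁ h₁ j h hne s, lev e₂ h₂ j h (by rwa [← hπ, ← hπ]) s, hπ]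
    · simp only [h, dif_neg, not_false_eq_true, hπ]
      have hall : ∀ i : Fin (Fintype.card S), i ≤ j := by
        intro i
        rw [Fin.le_def]
        have := i.isLt
        omega
      simp [hall]
  exact key _ _ (antitone_sortedEnum π) he

end SepConvex

/-!
Given an integral base `x` minimizing `∑ s, φ s (x s)`, preorder `S` by `t ≤ s` when every tight
set containing `t` contains `s`. For `t ≤ s` the vector `x + χ_s - χ_t` is again a base, so
minimality says that the left slope of `φ t` at `x t` is at most the right slope of `φ s` at `x s`.
Hence there is a monotone integral `π` lying between the two slopes in each coordinate. Discrete
convexity turns `π s` into a subgradient of `φ s`, while monotonicity makes the superlevel sets of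
`π` tight, since the tight sets form a lattice, so that `p̂(π) = ∑ s, π s * x s`. Thus `π` is a dual
solution of the same value.

If the primal problem is infeasible and `π₀` is dual feasible, replace `φ s` by its finite minorant
`k ↦ k * π₀ s - c s + N * dist(k, dom φ s)`, where `c s ≥ ψ s (π₀ s)` and the distance to the empty
set is read as `1`. Every integral base violates some domain, so the minimum of the sum is at least
`p̂(π₀) - ∑ s, c s + N`. The dual solution obtained from the finite case has at least this value for
the original `φ` too, and `N` is arbitrary.
-/

namespace SepConvex

section SetFamilies

variable {α : Type*} [DecidableEq α] {L : Set (Finset α)} {U : Finset α}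

theorem mem_of_forall_exists_mem_subset (hsup : SupClosed L) (hempty : ∅ ∈ L)
    (hU : ∀ t ∈ U, ∃ Z ∈ L, t ∈ Z ∧ Z ⊆ U) : U ∈ L := by
  choose! Z hZL htZ hZU using hU
  have hU_eq : U = U.sup Z :=
    Finset.Subset.antisymm (fun t ht => Finset.mem_sup.2 ⟨t, ht, htZ t ht⟩)
      (Finset.sup_le_iff.2 hZU)
  rw [hU_eq]
  exact Finset.sup_induction hempty (fun _ hX _ hY => hsup hX hY) hZL

theorem mem_of_forall_mem_of_forall_mem_imp [Fintype α] (hL : IsSublattice L) (hempty : ∅ ∈ L)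
    (huniv : Finset.univ ∈ L)
    (hU : ∀ t ∈ U, ∀ s, (∀ Z ∈ L, t ∈ Z → s ∈ Z) → s ∈ U) : U ∈ L := by
  classical
  refine mem_of_forall_exists_mem_subset hL.supClosed hempty fun t ht => ?_
  refine ⟨(Finset.univ.filter fun Z => Z ∈ L ∧ t ∈ Z).inf id, ?_, ?_, fun s hs => hU t ht s ?_⟩
  · exact Finset.inf_induction huniv (fun _ hX _ hY => hL.infClosed hX hY)
      fun Z hZ => (Finset.mem_filter.1 hZ).2.1
  · simp [Finset.mem_inf]
  · simpa [Finset.mem_inf] using hs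

end SetFamilies

section Bases

variable {S : Type*} {p : Finset S → WithBot ℤ} {x : S → ℤ}

/-- A vector `x` covers `p` if `p Z ≤ x̃ Z` for every `Z`; unlike a base, `x` may have
`x̃ S > p S`. -/
def Covers (p : Finset S → WithBot ℤ) (x : S → ℤ) : Prop :=
  ∀ Z : Finset S, p Z ≤ ((∑ s ∈ Z, x s : ℤ) : WithBot ℤ)

/-- A set `Z` is tight for `x` if `x̃ Z = p Z`. -/
def IsTight (p : Finset S → WithBot ℤ) (x : S → ℤ) (Z : Finset S) : Prop :=
  p Z = ((∑ s ∈ Z, x s : ℤ) : WithBot ℤ)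

/-- Every tight set containing `t` contains `s`. This preorder on `S` governs which exchanges
`x + χ_s - χ_t` remain in the base-polyhedron. -/
def TightLE (p : Finset S → WithBot ℤ) (x : S → ℤ) (t s : S) : Prop :=
  ∀ Z, IsTight p x Z → t ∈ Z → s ∈ Z

/-- Integral members of the base-polyhedron, described over the integers. -/
structure IsIntBase [Fintype S] (p : Finset S → WithBot ℤ) (x : S → ℤ) : Prop where
  covers : Covers p x
  isTight_univ : IsTight p x Finset.univ

theorem map_intCast_le_coe_iff {a : WithBot ℤ} {b : ℤ} :
    a.map (fun n : ℤ => (n : ℝ)) ≤ ((b : ℝ) : WithBot ℝ) ↔ a ≤ b := by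
  cases a <;> simp

theorem map_intCast_eq_coe_iff {a : WithBot ℤ} {b : ℤ} :
    a.map (fun n : ℤ => (n : ℝ)) = ((b : ℝ) : WithBot ℝ) ↔ a = b := by
  cases a <;> simp

theorem mem_integerPoints_basePolyhedron_iff [Fintype S] :
    x ∈ integerPoints (basePolyhedron p) ↔ IsIntBase p x := by
  simp only [integerPoints, basePolyhedron, Set.mem_ofPred_eq, ← Int.cast_sum,
    map_intCast_le_coe_iff, map_intCast_eq_coe_iff]
  refine ⟨fun ⟨huniv, hle⟩ => ⟨fun Z => ?_, huniv⟩,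
    fun h => ⟨h.isTight_univ, fun Z _ => h.covers Z⟩⟩
  rcases (Finset.subset_univ Z).eq_or_ssubset with rfl | hZ
  exacts [huniv.le, hle Z hZ]

theorem Covers.add (hx : Covers p x) {d : S → ℤ} (hd : ∀ Z : Finset S, -1 ≤ ∑ s ∈ Z, d s)
    (hd_tight : ∀ Z, IsTight p x Z → 0 ≤ ∑ s ∈ Z, d s) : Covers p (x + d) := by
  intro Z
  have hxZ := hx Z
  have hdZ := hd Z
  have htight := hd_tight Z
  unfold IsTight at htight
  simp only [Pi.add_apply, Finset.sum_add_distrib]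
  cases hZ : p Z with
  | bot => exact bot_le
  | coe a =>
    simp only [hZ, WithBot.coe_le_coe, WithBot.coe_inj] at hxZ htight ⊢
    omega

variable [DecidableEq S]

theorem IsIntBase.add_single_sub_single [Fintype S] (hx : IsIntBase p x) {s t : S}
    (hts : TightLE p x t s) : IsIntBase p (x + (Pi.single s 1 - Pi.single t 1)) := by
  have hsum (Z : Finset S) : ∑ q ∈ Z, (Pi.single s 1 - Pi.single t 1 : S → ℤ) q =
      (if s ∈ Z then 1 else 0) - if t ∈ Z then 1 else 0 := by
    simp [Finset.sum_sub_distrib, Finset.sum_pi_single']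
  constructor
  · refine hx.covers.add (fun Z => ?_) (fun Z hZ => ?_) <;> rw [hsum]
    · split_ifs <;> simp
    · have := hts Z hZ
      split_ifs <;> simp_all
  · have hxS := hx.isTight_univ
    simp only [IsTight, Pi.add_apply, Finset.sum_add_distrib, hsum] at hxS ⊢
    simpa using hxS

variable [Fintype S]

theorem isSublattice_setOf_isTight (hp : IsSupermodular p) (hx : Covers p x) :
    IsSublattice {Z | IsTight p x Z} := by
  suffices h : ∀ X Y, IsTight p x X → IsTight p x Y →
      IsTight p x (X ∪ Y) ∧ IsTight p x (X ∩ Y) from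
    ⟨fun X hX Y hY => (h X Y hX hY).1, fun X hX Y hY => (h X Y hX hY).2⟩
  intro X Y hX hY
  have hsuper := hp.supermodular X Y (hX ▸ WithBot.coe_ne_bot) (hY ▸ WithBot.coe_ne_bot)
  have hinter := hx (X ∩ Y)
  have hunion := hx (X ∪ Y)
  have hmodular : ∑ s ∈ X ∪ Y, x s + ∑ s ∈ X ∩ Y, x s = ∑ s ∈ X, x s + ∑ s ∈ Y, x s :=
    Finset.sum_union_inter
  unfold IsTight at hX hY ⊢
  rw [hX, hY, ← WithBot.coe_add] at hsuper
  have hne : p (X ∩ Y) + p (X ∪ Y) ≠ ⊥ := (WithBot.bot_lt_coe _).trans_le hsuper |>.ne'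
  obtain ⟨hI, hU⟩ := WithBot.add_ne_bot.1 hne
  obtain ⟨a, ha⟩ := WithBot.ne_bot_iff_exists.1 hI
  obtain ⟨b, hb⟩ := WithBot.ne_bot_iff_exists.1 hU
  simp only [← ha, ← hb, ← WithBot.coe_add, WithBot.coe_le_coe, WithBot.coe_inj] at *
  omega

theorem isTight_empty (hp : IsSupermodular p) (x : S → ℤ) : IsTight p x ∅ := by
  simp [IsTight, hp.empty]

theorem IsIntBase.isTight_of_forall_tightLE (hp : IsSupermodular p) (hx : IsIntBase p x)
    {U : Finset S} (hU : ∀ t ∈ U, ∀ s, TightLE p x t s → s ∈ U) : IsTight p x U :=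
  mem_of_forall_mem_of_forall_mem_imp (L := {Z | IsTight p x Z})
    (isSublattice_setOf_isTight hp hx.covers) (isTight_empty hp x) hx.isTight_univ hU

theorem exists_covers (hp : IsSupermodular p) : ∃ x, Covers p x := by
  obtain ⟨M, hM⟩ : ∃ M : ℤ, 0 ⊔ Finset.univ.sup p = M :=
    ⟨_, (WithBot.coe_unbot _ (ne_bot_of_le_ne_bot WithBot.zero_ne_bot le_sup_left)).symm⟩
  have hM0 : 0 ≤ M := by
    rw [← WithBot.coe_le_coe, ← hM]
    exact le_sup_left
  refine ⟨fun _ => M, fun Z => ?_⟩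
  rcases Z.eq_empty_or_nonempty with rfl | hZ
  · simp [hp.empty]
  · calc p Z ≤ (M : WithBot ℤ) := hM ▸ (Finset.le_sup (Finset.mem_univ Z)).trans le_sup_right
      _ ≤ ((∑ _ ∈ Z, M : ℤ) : WithBot ℤ) := by
        obtain ⟨s, hs⟩ := hZ
        exact WithBot.coe_le_coe.2 (Finset.single_le_sum (f := fun _ => M) (fun _ _ => hM0) hs)

theorem exists_isMinOn_of_bddBelow {α : Type*} {A : Set α} {F : α → WithTop ℤ}
    (hfin : ∃ x ∈ A, F x ≠ ⊤) (hbdd : BddBelow (F '' A)) :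
    ∃ x ∈ A, F x ≠ ⊤ ∧ IsMinOn F A x := by
  obtain ⟨x₀, hx₀A, hx₀⟩ := hfin
  obtain ⟨b, hb⟩ := hbdd
  rw [mem_lowerBounds, Set.forall_mem_image] at hb
  lift b to ℤ using ne_top_of_le_ne_top hx₀ (hb hx₀A)
  obtain ⟨n₀, hn₀⟩ := WithTop.ne_top_iff_exists.1 hx₀
  obtain ⟨m, ⟨x, hxA, hxm⟩, hmin⟩ := Int.exists_least_of_bdd (P := fun n => ∃ x ∈ A, F x = n)
    ⟨b, fun n ⟨x, hxA, hxn⟩ => WithTop.coe_le_coe.1 (hxn ▸ hb hxA)⟩ ⟨n₀, x₀, hx₀A, hn₀.symm⟩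
  refine ⟨x, hxA, hxm ▸ WithTop.coe_ne_top, fun y hyA => ?_⟩
  change F x ≤ F y
  rw [hxm]
  cases hy : F y with
  | top => exact le_top
  | coe n => exact WithTop.coe_le_coe.2 (hmin n ⟨y, hyA, hy⟩)

theorem exists_isIntBase (hp : IsSupermodular p) : ∃ x, IsIntBase p x := by
  obtain ⟨c, hc⟩ := WithBot.ne_bot_iff_exists.1 hp.univ_ne_bot
  obtain ⟨x₀, hx₀⟩ := exists_covers hp
  obtain ⟨x, hx, -, hmin⟩ := exists_isMinOn_of_bddBelow (A := {x | Covers p x})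
    (F := fun x => ((∑ s, x s : ℤ) : WithTop ℤ)) ⟨x₀, hx₀, WithTop.coe_ne_top⟩ <| by
      refine ⟨c, Set.forall_mem_image.2 fun y hy => WithTop.coe_le_coe.2 ?_⟩
      exact WithBot.coe_le_coe.1 (hc ▸ hy Finset.univ)
  -- If no tight set contained `t`, then `x - χ_t` would be a smaller covering vector.
  have htight : ∀ t, ∃ Z, IsTight p x Z ∧ t ∈ Z := by
    intro t
    by_contra! hnot
    have hsum (Z : Finset S) : ∑ s ∈ Z, (Pi.single t (-1) : S → ℤ) s = if t ∈ Z then -1 else 0 :=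
      Finset.sum_pi_single' ..
    have hlower : Covers p (x + Pi.single t (-1)) := by
      refine hx.add (fun Z => ?_) (fun Z hZ => ?_) <;> rw [hsum]
      · split_ifs <;> simp
      · rw [if_neg (hnot Z hZ)]
    have hle := WithTop.coe_le_coe.1 (hmin hlower)
    simp only [Pi.add_apply, Finset.sum_add_distrib, hsum, Finset.mem_univ, if_true] at hle
    omega
  exact ⟨x, hx, mem_of_forall_exists_mem_subset (L := {Z | IsTight p x Z})
    (isSublattice_setOf_isTight hp hx).supClosed (isTight_empty hp x)
    fun t _ => (htight t).imp fun Z hZ => ⟨hZ.1, hZ.2, Finset.subset_univ Z⟩⟩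

end Bases

section Lovasz

variable {S : Type*} [Fintype S] {p : Finset S → WithBot ℤ} {π x : S → ℤ}
  {e : Fin (Fintype.card S) ≃ S}

/-- The initial segment `I_j` of an enumeration of `S`. -/
def initialSegment (e : Fin (Fintype.card S) ≃ S) (j : Fin (Fintype.card S)) : Finset S :=
  Finset.univ.filter fun s => e.symm s ≤ j

/-- The coefficient `π(s_j) - π(s_{j+1})` of `p(I_j)` in the linear extension, to be read as
`π(s_n)` for the last index. -/
def gap (π : S → ℤ) (e : Fin (Fintype.card S) ≃ S) (j : Fin (Fintype.card S)) : ℤ :=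
  if h : (j : ℕ) + 1 < Fintype.card S then π (e j) - π (e ⟨j + 1, h⟩) else π (e j)

theorem lovaszAlong_eq_sum_mul_gap (p : Finset S → WithBot ℤ) (π : S → ℤ)
    (e : Fin (Fintype.card S) ≃ S) :
    lovaszAlong p π e = ∑ j, p (initialSegment e j) * (gap π e j : WithBot ℤ) :=
  rfl

theorem sum_Ici_gap (π : S → ℤ) (e : Fin (Fintype.card S) ≃ S) (i : Fin (Fintype.card S)) :
    ∑ j ∈ Finset.Ici i, gap π e j = π (e i) := by
  let g : ℕ → ℤ := fun k => if h : k < Fintype.card S then π (e ⟨k, h⟩) else 0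
  have hgap (j : Fin (Fintype.card S)) : gap π e j = g j - g (j + 1) := by
    by_cases h : (j : ℕ) + 1 < Fintype.card S <;> simp [gap, g, h]
  calc ∑ j ∈ Finset.Ici i, gap π e j
      = ∑ k ∈ (Finset.Ici i).map Fin.valEmbedding, (g k - g (k + 1)) := by
        rw [Finset.sum_map]
        exact Finset.sum_congr rfl fun j _ => hgap j
    _ = ∑ k ∈ Finset.Ico (i : ℕ) (Fintype.card S), (g k - g (k + 1)) := by
        rw [Fin.map_valEmbedding_Ici]
    _ = g i - g (Fintype.card S) := by
        rw [← neg_inj, ← Finset.sum_neg_distrib, neg_sub, ← Finset.sum_Ico_sub g i.isLt.le]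
        simp only [neg_sub]
    _ = π (e i) := by simp [g]

theorem sum_initialSegment_mul_gap (x π : S → ℤ) (e : Fin (Fintype.card S) ≃ S) :
    ∑ j, (∑ s ∈ initialSegment e j, x s) * gap π e j = ∑ s, π s * x s := by
  simp only [initialSegment, Finset.sum_filter, Finset.sum_mul]
  rw [Finset.sum_comm]
  refine Finset.sum_congr rfl fun s _ => ?_
  have hs := sum_Ici_gap π e (e.symm s)
  rw [Equiv.apply_symm_apply] at hs
  rw [← hs, mul_comm, Finset.mul_sum, ← Finset.filter_le_eq_Ici, Finset.sum_filter]
  simp only [ite_mul, zero_mul]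

theorem initialSegment_eq_univ {j : Fin (Fintype.card S)} (hj : ¬(j : ℕ) + 1 < Fintype.card S) :
    initialSegment e j = Finset.univ := by
  refine Finset.filter_true_of_mem fun s _ => Fin.le_def.2 ?_
  have := (e.symm s).isLt
  omega

theorem gap_nonneg (he : Antitone (π ∘ e)) {j : Fin (Fintype.card S)}
    (hj : (j : ℕ) + 1 < Fintype.card S) : 0 ≤ gap π e j := by
  have hle : π (e ⟨j + 1, hj⟩) ≤ π (e j) := he (Fin.le_def.2 (Nat.le_succ j))
  simpa [gap, hj] using hle

theorem initialSegment_eq_superlevel (he : Antitone (π ∘ e)) {j : Fin (Fintype.card S)}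
    (hj : gap π e j ≠ 0) : initialSegment e j = Finset.univ.filter fun s => π (e j) ≤ π s := by
  ext s
  simp only [initialSegment, Finset.mem_filter, Finset.mem_univ, true_and]
  refine ⟨fun hs => by simpa using he hs, fun hs => ?_⟩
  by_contra! hlt
  have hj1 : (j : ℕ) + 1 < Fintype.card S := (Nat.succ_le_of_lt hlt).trans_lt (e.symm s).isLt
  have hsucc : π s ≤ π (e ⟨j + 1, hj1⟩) := by
    simpa using he (show ⟨j + 1, hj1⟩ ≤ e.symm s from Nat.succ_le_of_lt hlt)
  have hgap := gap_nonneg he hj1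
  simp only [gap, hj1, dif_pos] at hj hgap
  omega

theorem lovaszExt_le_sum_mul (hx : IsIntBase p x) (π : S → ℤ) :
    lovaszExt p π ≤ ((∑ s, π s * x s : ℤ) : WithBot ℤ) := by
  rw [lovaszExt, lovaszAlong_eq_sum_mul_gap, ← sum_initialSegment_mul_gap x π (sortedEnum π),
    WithBot.coe_sum]
  refine Finset.sum_le_sum fun j _ => ?_
  rw [WithBot.coe_mul]
  by_cases hj : (j : ℕ) + 1 < Fintype.card S
  · exact mul_le_mul_of_nonneg_right (hx.covers _)
      (WithBot.coe_nonneg.2 (gap_nonneg (antitone_sortedEnum π) hj))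
  · rw [initialSegment_eq_univ hj, hx.isTight_univ]

theorem lovaszExt_eq_sum_mul
    (htight : ∀ c : ℤ, IsTight p x (Finset.univ.filter fun s => c ≤ π s)) :
    lovaszExt p π = ((∑ s, π s * x s : ℤ) : WithBot ℤ) := by
  rw [lovaszExt, lovaszAlong_eq_sum_mul_gap, ← sum_initialSegment_mul_gap x π (sortedEnum π),
    WithBot.coe_sum]
  refine Finset.sum_congr rfl fun j _ => ?_
  by_cases hj : gap π (sortedEnum π) j = 0
  · simp [hj]
  · rw [initialSegment_eq_superlevel (antitone_sortedEnum π) hj, htight, WithBot.coe_mul]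

end Lovasz

section DiscreteConvex

variable {φ : ℤ → WithTop ℤ} {k x g : ℤ}

/-- `g` is a subgradient of `φ` at `x`. -/
def IsSubgradient (φ : ℤ → WithTop ℤ) (x g : ℤ) : Prop :=
  ∀ k, φ x + ((k - x) * g : ℤ) ≤ φ k

theorem DiscreteConvex.comp_neg (hφ : DiscreteConvex φ) : DiscreteConvex fun k => φ (-k) where
  ordConnected_dom := hφ.ordConnected_dom.preimage_anti fun _ _ => neg_le_neg
  two_nsmul_le k hk := by
    convert hφ.two_nsmul_le (-k) hk using 1
    rw [add_comm]
    ring_nf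

theorem DiscreteConvex.add_le_succ (hφ : DiscreteConvex φ) (hk : φ k ≠ ⊤)
    (hslope : φ k + g ≤ φ (k + 1)) : φ (k + 1) + g ≤ φ (k + 2) := by
  by_cases hk2 : φ (k + 2) = ⊤
  · exact hk2 ▸ le_top
  have hk1 : φ (k + 1) ≠ ⊤ := hφ.ordConnected_dom.out hk hk2 ⟨by omega, by omega⟩
  have hconv := hφ.two_nsmul_le (k + 1) hk1
  rw [add_sub_cancel_right, add_assoc, one_add_one_eq_two, two_nsmul] at hconv
  obtain ⟨a, ha⟩ := WithTop.ne_top_iff_exists.1 hk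
  obtain ⟨b, hb⟩ := WithTop.ne_top_iff_exists.1 hk1
  obtain ⟨c, hc⟩ := WithTop.ne_top_iff_exists.1 hk2
  simp only [← ha, ← hb, ← hc, ← WithTop.coe_add, WithTop.coe_le_coe] at *
  omega

theorem DiscreteConvex.add_mul_le_of_add_le_succ (hφ : DiscreteConvex φ) (hx : φ x ≠ ⊤)
    (hslope : φ x + g ≤ φ (x + 1)) (hk : x ≤ k) : φ x + ((k - x) * g : ℤ) ≤ φ k := by
  suffices h : φ x + ((k - x) * g : ℤ) ≤ φ k ∧ φ k + g ≤ φ (k + 1) from h.1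
  induction k, hk using Int.leInduction with
  | base => simpa using hslope
  | succ k hk ih =>
    obtain ⟨hle, hslope_k⟩ := ih
    constructor
    · calc φ x + ((k + 1 - x) * g : ℤ) = φ x + ((k - x) * g : ℤ) + g := by
            rw [add_assoc, ← WithTop.coe_add]
            ring_nf
        _ ≤ φ k + g := by gcongr
        _ ≤ φ (k + 1) := hslope_k
    · by_cases htop : φ k = ⊤
      · have : φ (k + 1 + 1) = ⊤ := by
          by_contra hne
          exact hφ.ordConnected_dom.out hx hne ⟨hk, by omega⟩ htop
        exact this ▸ le_top
      · exact add_assoc k 1 1 ▸ hφ.add_le_succ htop hslope_k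

theorem DiscreteConvex.isSubgradient (hφ : DiscreteConvex φ) (hx : φ x ≠ ⊤)
    (hright : φ x + g ≤ φ (x + 1)) (hleft : φ x ≤ φ (x - 1) + g) : IsSubgradient φ x g := by
  intro k
  rcases le_total x k with hk | hk
  · exact hφ.add_mul_le_of_add_le_succ hx hright hk
  · have hslope : φ (- -x) + ((-g : ℤ) : WithTop ℤ) ≤ φ (-(-x + 1)) := by
      rw [neg_neg, neg_add, neg_neg, ← sub_eq_add_neg]
      calc φ x + ((-g : ℤ) : WithTop ℤ) ≤ φ (x - 1) + g + ((-g : ℤ) : WithTop ℤ) := by gcongr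
        _ = φ (x - 1) := by rw [add_assoc, ← WithTop.coe_add, add_neg_cancel]; simp
    have hneg := hφ.comp_neg.add_mul_le_of_add_le_succ (k := -k) (by rwa [neg_neg]) hslope
      (neg_le_neg hk)
    simp only [neg_neg] at hneg
    convert hneg using 3
    ring

theorem discreteConvex_coe {f : ℤ → ℤ} (hf : ∀ k, 2 * f k ≤ f (k - 1) + f (k + 1)) :
    DiscreteConvex fun k => (f k : WithTop ℤ) where
  ordConnected_dom := by simpa using Set.ordConnected_univ
  two_nsmul_le k _ := by
    rw [two_nsmul, ← WithTop.coe_add, ← WithTop.coe_add, WithTop.coe_le_coe, ← two_mul]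
    exact hf k

theorem exists_penalty {D : Set ℤ} (hD : D.OrdConnected) :
    ∃ δ : ℤ → ℤ, (∀ k, 2 * δ k ≤ δ (k - 1) + δ (k + 1)) ∧ (∀ k ∈ D, δ k = 0) ∧
      ∀ k ∉ D, 1 ≤ δ k := by
  rcases D.eq_empty_or_nonempty with rfl | hne
  · exact ⟨fun _ => 1, by simp⟩
  have hnearest : ∀ k, ∃ j ∈ D, ∀ i ∈ D, |k - j| ≤ |k - i| := fun k =>
    ⟨_, Function.argminOn_mem (fun j => (k - j).natAbs) D hne, fun i hi => by
      simpa only [Int.abs_eq_natAbs, Nat.cast_le] using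
        Function.argminOn_le (fun j => (k - j).natAbs) D hi⟩
  choose r hrD hr using hnearest
  refine ⟨fun k => |k - r k|, fun k => ?_, fun k hk => ?_, fun k hk => ?_⟩
  · -- The two roundings of the midpoint of `r (k - 1)` and `r (k + 1)` lie in `D`.
    have hfloor : (r (k - 1) + r (k + 1)) / 2 ∈ D :=
      hD.uIcc_subset (hrD (k - 1)) (hrD (k + 1)) (Set.mem_uIcc.2 (by omega))
    have hceil : (r (k - 1) + r (k + 1) + 1) / 2 ∈ D :=
      hD.uIcc_subset (hrD (k - 1)) (hrD (k + 1)) (Set.mem_uIcc.2 (by omega))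
    have hle_floor := hr k _ hfloor
    have hle_ceil := hr k _ hceil
    grind
  · simpa using hr k k hk
  · refine Int.one_le_abs fun h => hk ?_
    exact sub_eq_zero.1 h ▸ hrD k

end DiscreteConvex

section Conjugate

variable {φ : ℤ → WithTop ℤ} {k f l c g : ℤ}

@[simp] theorem topToEReal_top : topToEReal ⊤ = ⊤ := rfl

@[simp] theorem topToEReal_coe (n : ℤ) : topToEReal n = ((n : ℝ) : EReal) := rfl

@[simp] theorem botToEReal_bot : botToEReal ⊥ = ⊥ := rfl

@[simp] theorem botToEReal_coe (n : ℤ) : botToEReal n = ((n : ℝ) : EReal) := rfl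

theorem topToEReal_le_topToEReal_iff {a b : WithTop ℤ} : topToEReal a ≤ topToEReal b ↔ a ≤ b := by
  cases a <;> cases b <;> simp

theorem monotone_botToEReal : Monotone botToEReal := by
  intro a b hab
  cases a <;> cases b <;> simp_all

theorem coe_intCast_sum {ι : Type*} (s : Finset ι) (f : ι → ℤ) :
    (((∑ i ∈ s, f i : ℤ) : ℝ) : EReal) = ∑ i ∈ s, ((f i : ℝ) : EReal) := by
  rw [Int.cast_sum]
  exact map_sum (⟨⟨Real.toEReal, EReal.coe_zero⟩, EReal.coe_add⟩ : ℝ →+ EReal) _ _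

theorem coe_sub_le_intConj (hf : φ k = f) (l : ℤ) :
    (((k * l - f : ℤ) : ℝ) : EReal) ≤ intConj φ l := by
  refine le_of_eq_of_le ?_
    (le_iSup (fun k : ℤ => (((k * l : ℤ) : ℝ) : EReal) - topToEReal (φ k)) k)
  rw [hf, topToEReal_coe, Int.cast_sub, EReal.coe_sub]

theorem intConj_le_coe_iff : intConj φ l ≤ ((c : ℝ) : EReal) ↔ ∀ k, (k * l - c : ℤ) ≤ φ k := by
  refine iSup_le_iff.trans (forall_congr' fun k => ?_)
  cases φ k with
  | top => simp
  | coe f =>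
    rw [topToEReal_coe, ← EReal.coe_sub, EReal.coe_le_coe_iff, ← Int.cast_sub, Int.cast_le,
      WithTop.coe_le_coe, sub_le_comm]

theorem IsSubgradient.intConj_le (hg : IsSubgradient φ k g) (hf : φ k = f) :
    intConj φ g ≤ (((k * g - f : ℤ) : ℝ) : EReal) := by
  refine intConj_le_coe_iff.2 fun i => le_of_eq_of_le ?_ (hg i)
  rw [hf, ← WithTop.coe_add]
  ring_nf

theorem intConj_anti {φ' : ℤ → WithTop ℤ} (h : φ ≤ φ') (l : ℤ) : intConj φ' l ≤ intConj φ l :=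
  iSup_mono fun k => EReal.sub_le_sub le_rfl (topToEReal_le_topToEReal_iff.2 (h k))

end Conjugate

section Duality

variable {S : Type*} [Fintype S] {p : Finset S → WithBot ℤ} {φ : S → ℤ → WithTop ℤ} {x π : S → ℤ}

/-- The objective `p̂(π) - ∑ s, ψ_s(π(s))` of the dual problem. -/
noncomputable def dualObjective (p : Finset S → WithBot ℤ) (φ : S → ℤ → WithTop ℤ)
    (π : S → ℤ) : EReal :=
  botToEReal (lovaszExt p π) - ∑ s, intConj (φ s) (π s)

theorem coe_le_dualObjective {a : ℤ} {c : S → ℤ} (ha : a ≤ lovaszExt p π)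
    (hc : ∀ s, intConj (φ s) (π s) ≤ ((c s : ℝ) : EReal)) :
    (((a - ∑ s, c s : ℤ) : ℝ) : EReal) ≤ dualObjective p φ π := by
  rw [Int.cast_sub, EReal.coe_sub, coe_intCast_sum]
  exact EReal.sub_le_sub (monotone_botToEReal ha) (Finset.sum_le_sum fun s _ => hc s)

theorem dualObjective_le_coe {a : ℤ} {c : S → ℤ} (ha : lovaszExt p π ≤ a)
    (hc : ∀ s, ((c s : ℝ) : EReal) ≤ intConj (φ s) (π s)) :
    dualObjective p φ π ≤ (((a - ∑ s, c s : ℤ) : ℝ) : EReal) := by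
  rw [Int.cast_sub, EReal.coe_sub, coe_intCast_sum]
  exact EReal.sub_le_sub (monotone_botToEReal ha) (Finset.sum_le_sum fun s _ => hc s)

theorem dualObjective_mono {φ' : S → ℤ → WithTop ℤ} (h : ∀ s, φ s ≤ φ' s) (π : S → ℤ) :
    dualObjective p φ π ≤ dualObjective p φ' π :=
  EReal.sub_le_sub le_rfl (Finset.sum_le_sum fun s _ => intConj_anti (h s) (π s))

theorem exists_coe_eq_of_sum_ne_top (h : ∑ s, φ s (x s) ≠ ⊤) :
    ∃ f : S → ℤ, ∀ s, φ s (x s) = f s := by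
  choose f hf using fun s =>
    WithTop.ne_top_iff_exists.1 (WithTop.sum_ne_top.1 h s (Finset.mem_univ s))
  exact ⟨f, fun s => (hf s).symm⟩

theorem sum_mul_sub_sum_mul_sub (x π f : S → ℤ) :
    ∑ s, π s * x s - ∑ s, (x s * π s - f s) = ∑ s, f s := by
  simp only [Finset.sum_sub_distrib, mul_comm (x _), sub_sub_cancel]

theorem dualObjective_le_sum (hx : IsIntBase p x) (φ : S → ℤ → WithTop ℤ) (π : S → ℤ) :
    dualObjective p φ π ≤ topToEReal (∑ s, φ s (x s)) := by
  by_cases htop : ∑ s, φ s (x s) = ⊤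
  · exact htop ▸ le_top
  obtain ⟨f, hf⟩ := exists_coe_eq_of_sum_ne_top htop
  refine (dualObjective_le_coe (lovaszExt_le_sum_mul hx π)
    fun s => coe_sub_le_intConj (hf s) (π s)).trans_eq ?_
  rw [sum_mul_sub_sum_mul_sub, Finset.sum_congr rfl fun s _ => hf s, ← WithTop.coe_sum,
    topToEReal_coe]

theorem sum_le_dualObjective (hfin : ∑ s, φ s (x s) ≠ ⊤)
    (hπ : lovaszExt p π = ((∑ s, π s * x s : ℤ) : WithBot ℤ))
    (hsub : ∀ s, IsSubgradient (φ s) (x s) (π s)) :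
    topToEReal (∑ s, φ s (x s)) ≤ dualObjective p φ π := by
  obtain ⟨f, hf⟩ := exists_coe_eq_of_sum_ne_top hfin
  refine le_of_eq_of_le ?_ (coe_le_dualObjective hπ.ge fun s => (hsub s).intConj_le (hf s))
  rw [sum_mul_sub_sum_mul_sub, Finset.sum_congr rfl fun s _ => hf s, ← WithTop.coe_sum,
    topToEReal_coe]

end Duality

section StrongDuality

variable {S : Type*}

theorem exists_monotone_ge_mem [Finite S] [Preorder S] {α : Type*} [LinearOrder α] {l : S → α}
    {R : S → Set α} (h : ∀ t s, t ≤ s → l t ∈ R s) :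
    ∃ π : S → α, Monotone π ∧ l ≤ π ∧ ∀ s, π s ∈ R s := by
  have hmax : ∀ s, ∃ t ≤ s, ∀ q ≤ s, l q ≤ l t := fun s =>
    Set.exists_max_image (Set.Iic s) l (Set.toFinite _) ⟨s, le_rfl⟩
  choose m hm hmax using hmax
  exact ⟨l ∘ m, fun s q hsq => hmax q _ ((hm s).trans hsq), fun s => hmax s s le_rfl,
    fun s => h _ _ (hm s)⟩

theorem exists_forall_add_le [Finite S] {a b : S → WithTop ℤ} (ha : ∀ s, a s ≠ ⊤) :
    ∃ M : ℤ, ∀ s, a s + M ≤ b s := by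
  lift a to S → ℤ using ha
  obtain ⟨M, hM⟩ := Finite.bddBelow_range fun s => (b s).untopD 0 - a s
  refine ⟨M, fun s => ?_⟩
  have hMs : M ≤ (b s).untopD 0 - a s := hM ⟨s, rfl⟩
  cases hb : b s with
  | top => exact le_top
  | coe n =>
    rw [hb, WithTop.untopD_coe] at hMs
    rw [← WithTop.coe_add, WithTop.coe_le_coe]
    omega

theorem exists_between_of_forall_add_le [Finite S] {R : S → Prop} {a b : S → WithTop ℤ}
    {u v : WithTop ℤ} (ha : ∀ s, a s ≠ ⊤) (hu : u ≠ ⊤)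
    (h : ∀ s, R s → a s + u ≤ b s + v) :
    ∃ l : ℤ, u ≤ v + l ∧ ∀ s, R s → a s + l ≤ b s := by
  lift u to ℤ using hu
  cases v with
  | top =>
    obtain ⟨M, hM⟩ := exists_forall_add_le (b := b) ha
    exact ⟨M, by simp, fun s _ => hM s⟩
  | coe v =>
    refine ⟨u - v, by rw [← WithTop.coe_add, add_sub_cancel], fun s hs => ?_⟩
    refine (WithTop.add_le_add_iff_right (WithTop.coe_ne_top (a := v))).1 ?_
    rw [add_assoc, ← WithTop.coe_add, sub_add_cancel]
    exact h s hs

variable [Fintype S] {p : Finset S → WithBot ℤ} {φ : S → ℤ → WithTop ℤ} {x : S → ℤ}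

theorem add_le_add_of_sum_le_sum {y : S → ℤ} {s t : S} (hfin : ∑ q, φ q (x q) ≠ ⊤) (hst : s ≠ t)
    (hy : ∀ q, q ≠ s → q ≠ t → y q = x q) (h : ∑ q, φ q (x q) ≤ ∑ q, φ q (y q)) :
    φ s (x s) + φ t (x t) ≤ φ s (y s) + φ t (y t) := by
  classical
  have hsplit (z : S → ℤ) :
      ∑ q, φ q (z q) = φ s (z s) + φ t (z t) + ∑ q ∈ {s, t}ᶜ, φ q (z q) := by
    rw [← Finset.sum_add_sum_compl {s, t}, Finset.sum_pair hst]
  have hrest : ∑ q ∈ {s, t}ᶜ, φ q (y q) = ∑ q ∈ {s, t}ᶜ, φ q (x q) := by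
    refine Finset.sum_congr rfl fun q hq => ?_
    simp only [Finset.mem_compl, Finset.mem_insert, Finset.mem_singleton, not_or] at hq
    rw [hy q hq.1 hq.2]
  have hrest_fin : ∑ q ∈ {s, t}ᶜ, φ q (x q) ≠ ⊤ :=
    WithTop.sum_ne_top.2 fun q _ => WithTop.sum_ne_top.1 hfin q (Finset.mem_univ q)
  rwa [hsplit x, hsplit y, hrest, WithTop.add_le_add_iff_right hrest_fin] at h

theorem add_le_add_of_tightLE (hφ : ∀ s, DiscreteConvex (φ s)) (hx : IsIntBase p x)
    (hfin : ∑ s, φ s (x s) ≠ ⊤)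
    (hmin : IsMinOn (fun y => ∑ s, φ s (y s)) {y | IsIntBase p y} x) {s t : S}
    (hts : TightLE p x t s) : φ s (x s) + φ t (x t) ≤ φ s (x s + 1) + φ t (x t - 1) := by
  classical
  by_cases hst : s = t
  · subst hst
    rw [← two_nsmul, add_comm (φ s (x s + 1))]
    exact (hφ s).two_nsmul_le _ (WithTop.sum_ne_top.1 hfin s (Finset.mem_univ s))
  · have hle := add_le_add_of_sum_le_sum hfin hst (fun q hqs hqt => by simp [hqs, hqt])
      (hmin (hx.add_single_sub_single hts))
    simpa [hst, Ne.symm hst, ← sub_eq_add_neg] using hle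

theorem exists_isSubgradient_tightLE_monotone (hφ : ∀ s, DiscreteConvex (φ s))
    (hx : IsIntBase p x) (hfin : ∑ s, φ s (x s) ≠ ⊤)
    (hmin : IsMinOn (fun y => ∑ s, φ s (y s)) {y | IsIntBase p y} x) :
    ∃ π : S → ℤ, (∀ s, IsSubgradient (φ s) (x s) (π s)) ∧
      ∀ t s, TightLE p x t s → π t ≤ π s := by
  have hfin' : ∀ s, φ s (x s) ≠ ⊤ := fun s => WithTop.sum_ne_top.1 hfin s (Finset.mem_univ s)
  have hslopes : ∀ t, ∃ l : ℤ, φ t (x t) ≤ φ t (x t - 1) + l ∧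
      ∀ s, TightLE p x t s → φ s (x s) + l ≤ φ s (x s + 1) := fun t =>
    exists_between_of_forall_add_le hfin' (hfin' t) fun s hts =>
      add_le_add_of_tightLE hφ hx hfin hmin hts
  choose l hleft hright using hslopes
  let _ : Preorder S :=
    { le := TightLE p x
      le_refl := fun _ _ _ h => h
      le_trans := fun _ _ _ hab hbc Z hZ h => hbc Z hZ (hab Z hZ h) }
  obtain ⟨π, hmono, hlπ, hπ⟩ := exists_monotone_ge_mem (l := l)
    (R := fun s => {g : ℤ | φ s (x s) + g ≤ φ s (x s + 1)}) fun t s hts => hright t s hts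
  refine ⟨π, fun s => (hφ s).isSubgradient (hfin' s) (hπ s) ((hleft s).trans ?_),
    fun t s hts => hmono hts⟩
  gcongr
  exact WithTop.coe_le_coe.2 (hlπ s)

variable [DecidableEq S]

theorem exists_dualObjective_eq_sum (hp : IsSupermodular p) (hφ : ∀ s, DiscreteConvex (φ s))
    (hx : IsIntBase p x) (hfin : ∑ s, φ s (x s) ≠ ⊤)
    (hmin : IsMinOn (fun y => ∑ s, φ s (y s)) {y | IsIntBase p y} x) :
    ∃ π, dualObjective p φ π = topToEReal (∑ s, φ s (x s)) := by
  obtain ⟨π, hsub, hmono⟩ := exists_isSubgradient_tightLE_monotone hφ hx hfin hmin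
  have hπ : lovaszExt p π = ((∑ s, π s * x s : ℤ) : WithBot ℤ) := by
    refine lovaszExt_eq_sum_mul fun c => hx.isTight_of_forall_tightLE hp fun t ht s hts => ?_
    simp only [Finset.mem_filter, Finset.mem_univ, true_and] at ht ⊢
    exact ht.trans (hmono t s hts)
  exact ⟨π, (dualObjective_le_sum hx φ π).antisymm (sum_le_dualObjective hfin hπ hsub)⟩

theorem exists_isLeast_isGreatest (hp : IsSupermodular p) (hφ : ∀ s, DiscreteConvex (φ s))
    (hx : IsIntBase p x) (hfin : ∑ s, φ s (x s) ≠ ⊤)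
    (hmin : IsMinOn (fun y => ∑ s, φ s (y s)) {y | IsIntBase p y} x) :
    ∃ m : ℤ,
      IsLeast ((fun y => topToEReal (∑ s, φ s (y s))) '' {y | IsIntBase p y}) ((m : ℝ) : EReal) ∧
      IsGreatest (Set.range (dualObjective p φ)) ((m : ℝ) : EReal) := by
  obtain ⟨π, hπ⟩ := exists_dualObjective_eq_sum hp hφ hx hfin hmin
  obtain ⟨m, hm⟩ := WithTop.ne_top_iff_exists.1 hfin
  refine ⟨m, ?_⟩
  rw [← topToEReal_coe, hm]
  exact ⟨⟨Set.mem_image_of_mem _ hx, Set.forall_mem_image.2 fun y hy =>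
      topToEReal_le_topToEReal_iff.2 (hmin hy)⟩,
    ⟨π, hπ⟩, Set.forall_mem_range.2 (dualObjective_le_sum hx φ)⟩

theorem exists_le_dualObjective (hp : IsSupermodular p) (hφ : ∀ s, DiscreteConvex (φ s)) {b : ℤ}
    (hfin : ∀ s k, φ s k ≠ ⊤) (hb : ∀ x, IsIntBase p x → (b : WithTop ℤ) ≤ ∑ s, φ s (x s)) :
    ∃ π, ((b : ℝ) : EReal) ≤ dualObjective p φ π := by
  obtain ⟨x₀, hx₀⟩ := exists_isIntBase hp
  obtain ⟨x, hx, hxfin, hmin⟩ := exists_isMinOn_of_bddBelow (A := {x | IsIntBase p x})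
    (F := fun x => ∑ s, φ s (x s)) ⟨x₀, hx₀, WithTop.sum_ne_top.2 fun s _ => hfin s _⟩
    ⟨b, Set.forall_mem_image.2 hb⟩
  obtain ⟨π, hπ⟩ := exists_dualObjective_eq_sum hp hφ hx hxfin hmin
  exact ⟨π, hπ ▸ topToEReal_le_topToEReal_iff.2 (hb x hx)⟩

theorem exists_add_natCast_le_dualObjective (hp : IsSupermodular p)
    (hφ : ∀ s, DiscreteConvex (φ s)) (hinf : ∀ x, IsIntBase p x → ∑ s, φ s (x s) = ⊤)
    {π₀ : S → ℤ} {a : ℤ} {c : S → ℤ} (ha : a ≤ lovaszExt p π₀)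
    (hc : ∀ s, intConj (φ s) (π₀ s) ≤ ((c s : ℝ) : EReal)) (N : ℕ) :
    ∃ π, (((a - ∑ s, c s + N : ℤ) : ℝ) : EReal) ≤ dualObjective p φ π := by
  choose δ hδ_conv hδ_dom hδ_out using fun s => exists_penalty (hφ s).ordConnected_dom
  have hδ_nonneg : ∀ s k, 0 ≤ δ s k := fun s k => by
    by_cases hk : φ s k = ⊤
    exacts [zero_le_one.trans (hδ_out s k (not_not.2 hk)), (hδ_dom s k hk).ge]
  let g : S → ℤ → ℤ := fun s k => k * π₀ s - c s + N * δ s k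
  have hg_conv : ∀ s, DiscreteConvex fun k => (g s k : WithTop ℤ) := fun s =>
    discreteConvex_coe fun k => by
      linarith [mul_le_mul_of_nonneg_left (hδ_conv s k) (Nat.cast_nonneg' (α := ℤ) N)]
  have hg_le : ∀ s, (fun k => (g s k : WithTop ℤ)) ≤ φ s := fun s k => by
    by_cases hk : φ s k = ⊤
    · exact hk ▸ le_top
    · simpa [g, hδ_dom s k hk] using intConj_le_coe_iff.1 (hc s) k
  have hg_sum : ∀ x, IsIntBase p x → a - ∑ s, c s + N ≤ ∑ s, g s (x s) := fun x hx => by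
    obtain ⟨s, -, hs⟩ := WithTop.sum_eq_top.1 (hinf x hx)
    have hδ_sum : 1 ≤ ∑ s, δ s (x s) := (hδ_out s (x s) (not_not.2 hs)).trans
      (Finset.single_le_sum (fun s _ => hδ_nonneg s (x s)) (Finset.mem_univ s))
    have hNδ : (N : ℤ) ≤ N * ∑ s, δ s (x s) := le_mul_of_one_le_right N.cast_nonneg' hδ_sum
    have haπ₀ : a ≤ ∑ s, π₀ s * x s :=
      WithBot.coe_le_coe.1 (ha.trans (lovaszExt_le_sum_mul hx π₀))
    simp only [g, Finset.sum_add_distrib, Finset.sum_sub_distrib, ← Finset.mul_sum,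
      mul_comm (x _)]
    linarith
  obtain ⟨π, hπ⟩ := exists_le_dualObjective hp hg_conv (fun _ _ => WithTop.coe_ne_top)
    fun x hx => by
      rw [← WithTop.coe_sum]
      exact WithTop.coe_le_coe.2 (hg_sum x hx)
  exact ⟨π, hπ.trans (dualObjective_mono hg_le π)⟩

theorem iSup_dualObjective_eq_top (hp : IsSupermodular p) (hφ : ∀ s, DiscreteConvex (φ s))
    (hinf : ∀ x, IsIntBase p x → ∑ s, φ s (x s) = ⊤) {π₀ : S → ℤ} (hπ₀ : ⊥ < lovaszExt p π₀)
    (hψ : ∀ s, intConj (φ s) (π₀ s) < ⊤) : ⨆ π, dualObjective p φ π = ⊤ := by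
  obtain ⟨a, ha⟩ := WithBot.ne_bot_iff_exists.1 hπ₀.ne'
  have hbound : ∀ s, ∃ c : ℤ, intConj (φ s) (π₀ s) ≤ ((c : ℝ) : EReal) := fun s => by
    obtain ⟨r, hr, -⟩ := EReal.lt_iff_exists_real_btwn.1 (hψ s)
    exact ⟨⌈r⌉, hr.le.trans (EReal.coe_le_coe_iff.2 (Int.le_ceil r))⟩
  choose c hc using hbound
  refine (EReal.eq_top_iff_forall_lt _).2 fun y => ?_
  obtain ⟨N, hN⟩ := exists_nat_gt (y - (a - ∑ s, c s : ℤ))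
  obtain ⟨π, hπ⟩ := exists_add_natCast_le_dualObjective hp hφ hinf ha.le hc N
  refine lt_of_lt_of_le (EReal.coe_lt_coe_iff.2 ?_) (hπ.trans (le_iSup _ π))
  rw [Int.cast_add, Int.cast_natCast]
  linarith

end StrongDuality

theorem bddBelow_image_of_iInf_topToEReal_ne_bot {α : Type*} {A : Set α} {F : α → WithTop ℤ}
    (h : ⨅ x ∈ A, topToEReal (F x) ≠ ⊥) : BddBelow (F '' A) := by
  obtain ⟨r, -, hr⟩ := EReal.lt_iff_exists_real_btwn.1 (bot_lt_iff_ne_bot.2 h)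
  refine ⟨(⌊r⌋ : ℤ), Set.forall_mem_image.2 fun x hx => topToEReal_le_topToEReal_iff.1 ?_⟩
  calc topToEReal (⌊r⌋ : ℤ) ≤ (r : EReal) := EReal.coe_le_coe_iff.2 (Int.floor_le r)
    _ ≤ topToEReal (F x) := hr.le.trans (iInf₂_le x hx)

end SepConvex

theorem mainTheorem5 {S : Type*} [Fintype S] [DecidableEq S] [Nonempty S]
    (p : Finset S → WithBot ℤ) (hp : SepConvex.IsSupermodular p)
    (φ : S → ℤ → WithTop ℤ) (hφ : ∀ s, SepConvex.DiscreteConvex (φ s))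
    (hfeas :
      (∃ x ∈ SepConvex.integerPoints (SepConvex.basePolyhedron p), ∀ s, φ s (x s) < ⊤) ∨
      (∃ π : S → ℤ, ⊥ < SepConvex.lovaszExt p π ∧ ∀ s, SepConvex.intConj (φ s) (π s) < ⊤)) :
    (⨅ x ∈ SepConvex.integerPoints (SepConvex.basePolyhedron p),
        SepConvex.topToEReal (∑ s, φ s (x s))) =
      (⨆ π : S → ℤ, SepConvex.botToEReal (SepConvex.lovaszExt p π)
        - ∑ s, SepConvex.intConj (φ s) (π s)) ∧
    ((⨅ x ∈ SepConvex.integerPoints (SepConvex.basePolyhedron p),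
        SepConvex.topToEReal (∑ s, φ s (x s))) ≠ ⊥ →
     (⨅ x ∈ SepConvex.integerPoints (SepConvex.basePolyhedron p),
        SepConvex.topToEReal (∑ s, φ s (x s))) ≠ ⊤ →
      ∃ m : ℤ,
        IsLeast ((fun x : S → ℤ => SepConvex.topToEReal (∑ s, φ s (x s))) ''
          SepConvex.integerPoints (SepConvex.basePolyhedron p)) ((m : ℝ) : EReal) ∧
        IsGreatest (Set.range fun π : S → ℤ =>
          SepConvex.botToEReal (SepConvex.lovaszExt p π)
            - ∑ s, SepConvex.intConj (φ s) (π s)) ((m : ℝ) : EReal)) := by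
  have hmem : SepConvex.integerPoints (SepConvex.basePolyhedron p) =
      {x | SepConvex.IsIntBase p x} :=
    Set.ext fun _ => SepConvex.mem_integerPoints_basePolyhedron_iff
  rw [hmem] at hfeas ⊢
  change _ = ⨆ π, SepConvex.dualObjective p φ π ∧ (_ → _ → ∃ m : ℤ, _ ∧
    IsGreatest (Set.range (SepConvex.dualObjective p φ)) _)
  by_cases hprimal : ∃ x ∈ {x | SepConvex.IsIntBase p x}, ∑ s, φ s (x s) ≠ ⊤
  · by_cases hbot : ⨅ x ∈ {x | SepConvex.IsIntBase p x}, SepConvex.topToEReal (∑ s, φ s (x s)) = ⊥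
    · refine ⟨hbot.trans (eq_bot_mono ?_ hbot).symm, fun hne => absurd hbot hne⟩
      exact iSup_le fun π => le_iInf₂ fun x hx => SepConvex.dualObjective_le_sum hx φ π
    obtain ⟨x, hx, hfin, hmin⟩ := SepConvex.exists_isMinOn_of_bddBelow hprimal
      (SepConvex.bddBelow_image_of_iInf_topToEReal_ne_bot hbot)
    obtain ⟨m, hleast, hgreatest⟩ := SepConvex.exists_isLeast_isGreatest hp hφ hx hfin hmin
    refine ⟨?_, fun _ _ => ⟨m, hleast, hgreatest⟩⟩
    rw [← sInf_image, hleast.csInf_eq, iSup, hgreatest.csSup_eq]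
  · push Not at hprimal
    have htop : ⨅ x ∈ {x | SepConvex.IsIntBase p x},
        SepConvex.topToEReal (∑ s, φ s (x s)) = ⊤ :=
      iInf₂_eq_top.2 fun x hx => hprimal x hx ▸ SepConvex.topToEReal_top
    refine ⟨htop.trans ?_, fun _ hne => absurd htop hne⟩
    rcases hfeas with ⟨x, hx, hφx⟩ | ⟨π, hπ, hψ⟩
    · exact absurd (hprimal x hx) (WithTop.sum_ne_top.2 fun s _ => (hφx s).ne)
    · exact (SepConvex.iSup_dualObjective_eq_top hp hφ hprimal hπ hψ).symm
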